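/- Graphs are finite and loopless; multiple edges are allowed. A graph is matching covered if it is connected, has at least one edge, and each of its edges lies in a perfect matching. For $X\subseteq V(G)$ let $\overline X=V(G)\setminus X$, let $\partial(X)$ be the cut consisting of the edges with exactly one end in $X$, and let $G/X$ be the graph obtained from $G$ by merging the vertices of $X$ into a single vertex and removing the edges with both ends in $X$ (parallel edges are kept). The $C$-contractions of $G$, for $C=\partial(X)$, are $G/X$ and $G/\overline X$; the cut $C$ of a matching covered graph $G$ is separating if both are matching covered. An orientation of $G$ induces an orientation of each $C$-contraction. Fix an enumeration $1,\dots,2n$ of the vertices of a graph $G$ (of even order). If $D$ is an orientation of $G$ and $M$ is a perfect matching of $G$ consisting of arcs $u_1v_1,\dots,u_nv_n$ of $D$ ($u_j$ being the tail and $v_j$ the head), then $\mathrm{sign}_D(M)$ is the sign of the permutation $\begin{pmatrix}1&2&\cdots&2n-1&2n\\u_1&v_1&\cdots&u_n&v_n\end{pmatrix}$. A $k$-orientation $\mathbf D=(D_1,\dots,D_k)$ of $G$, a vector of $k$ orientations, is pfaffian if there is $x\in\mathbb R^k$ such that $\sum_{i=1}^k \mathrm{sign}_{D_i}(M)\,x_i=1$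 for every perfect matching $M$ of $G$ (this does not depend on the enumeration). The pfaffian number $\mathrm{pf}(G)$ is the least positive integer $k$ for which $G$ has a pfaffian $k$-orientation. Two $k$-orientations $\mathbf D,\mathbf D'$ of $G$ are similar if, for each $i$, $D'_i$ is obtained from $D_i$ by reversing all the edges of some cut $\partial(S_i)$, $S_i\subseteq V(G)$. **Theorem.** Let $C=\partial(X)$ be a separating cut of a matching covered graph $G$ and let $\mathbf D^{(0)}$ be a pfaffian $\mathrm{pf}(G)$-orientation of $G$. Then $G$ has a $\mathrm{pf}(G)$-orientation $\mathbf D$ similar to $\mathbf D^{(0)}$ such that both $C$-contractions of $\mathbf D$, that is, the $\mathrm{pf}(G)$-orientations that $\mathbf D$ induces on $G/X$ and on $G/\overline X$, are pfaffian. -/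

import Mathlib

open scoped Graph

namespace Graph

variable {α β : Type*}

/-- The cut `∂(X)` with shore `X`: the edges of `G` with one end in `X` and the other end outside. -/
def cut (G : Graph α β) (X : Set α) : Set β :=
  {e | ∃ x ∈ X, ∃ y ∉ X, G.IsLink e x y}

/-- The edges of `G` with both ends in `X`. -/
def innerEdges (G : Graph α β) (X : Set α) : Set β :=
  {e | ∃ x ∈ X, ∃ y ∈ X, G.IsLink e x y}

open Classical in
/-- The map on vertices identifying all the vertices of `X` with the single new vertex `none`. -/
noncomputable def contractVertex (X : Set α) (v : α) : Option α :=
  if v ∈ X then none else some v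

/-- The contraction `G / X`: the vertices in `X` are merged into a single vertex, and the edges with
both ends in `X`, which would become loops, are removed. All the other edges are kept,
so parallel edges may arise. -/
noncomputable def contract (G : Graph α β) (X : Set α) : Graph (Option α) β :=
  (G.deleteEdges (G.innerEdges X)).map (contractVertex X)

/-- A perfect matching of a loopless graph `G`, as a set of edges. -/
def IsPerfectMatching (G : Graph α β) (M : Set β) : Prop :=
  M ⊆ E(G) ∧ ∀ v ∈ V(G), ∃! e, e ∈ M ∧ G.Inc e v

/-- A (loopless) graph is matching covered if it is connected, has at least one edge, and each edge
lies in some perfect matching. -/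
def IsMatchingCovered (G : Graph α β) : Prop :=
  G.toSimpleGraph.Connected ∧ E(G).Nonempty ∧
    ∀ e ∈ E(G), ∃ M : Set β, G.IsPerfectMatching M ∧ e ∈ M

/-- The cut `∂(X)` of `G` is separating: both of its contractions `G / X` and `G / (V(G) \ X)` are
matching covered. -/
def IsSeparatingCut (G : Graph α β) (X : Set α) : Prop :=
  (G.contract X).IsMatchingCovered ∧ (G.contract (V(G) \ X)).IsMatchingCovered

/-- An orientation of `G`: each edge gets one of its ends as tail and the other one as head. -/
@[ext]
structure Orientation (G : Graph α β) where
  tail : E(G) → α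
  head : E(G) → α
  isLink : ∀ e : E(G), G.IsLink e (tail e) (head e)

namespace Orientation

variable {G : Graph α β}

open Classical in
/-- `D rev F`: reverse the direction of all the edges in `F`. -/
noncomputable def rev (D : G.Orientation) (F : Set β) : G.Orientation where
  tail e := if (e : β) ∈ F then D.head e else D.tail e
  head e := if (e : β) ∈ F then D.tail e else D.head e
  isLink e := by
    by_cases h : (e : β) ∈ F
    · simpa [h] using (D.isLink e).symm
    · simpa [h] using D.isLink e

/-- Two orientations are similar if one arises from the other by reversing a cut. -/
def Similar (D D' : G.Orientation) : Prop :=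
  ∃ S ⊆ V(G), D' = D.rev (G.cut S)

/-- The orientation of `G / X` induced by an orientation of `G`. -/
noncomputable def contract (D : G.Orientation) (X : Set α) : (G.contract X).Orientation where
  tail e := contractVertex X (D.tail ⟨e.1, e.2.1⟩)
  head e := contractVertex X (D.head ⟨e.1, e.2.1⟩)
  isLink e := ⟨_, _, ⟨D.isLink ⟨e.1, e.2.1⟩, e.2.2⟩, rfl, rfl⟩

/-- Let `ν` be an enumeration of the `2k` vertices of `G`. The permutation `π` of the indices is a
permutation of `M` in `D` if it is of the form `(u₁ v₁ u₂ v₂ … u_k v_k)`, where each `u_i v_i` is an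
edge of `M` oriented from `u_i` to `v_i`. -/
def IsPermOf {k : ℕ} (ν : Fin (2 * k) ≃ V(G)) (D : G.Orientation) (M : Set β)
    (π : Equiv.Perm (Fin (2 * k))) : Prop :=
  ∀ i : Fin k, ∃ e : E(G), (e : β) ∈ M ∧
    D.tail e = ν (π ⟨2 * i, by omega⟩) ∧ D.head e = ν (π ⟨2 * i + 1, by omega⟩)

open Classical in
/-- The sign of `M` in `D` with respect to the enumeration `ν`. -/
noncomputable def sign {k : ℕ} (ν : Fin (2 * k) ≃ V(G)) (D : G.Orientation) (M : Set β) : ℤˣ :=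
  if h : ∃ π, IsPermOf ν D M π then Equiv.Perm.sign h.choose else 1

/-- The sign of a perfect matching may be computed with any of its permutations. -/
theorem sign_eq {k : ℕ} {ν : Fin (2 * k) ≃ V(G)} {D : G.Orientation} {M : Set β}
    (hM : G.IsPerfectMatching M) {π : Equiv.Perm (Fin (2 * k))} (hπ : IsPermOf ν D M π) :
    D.sign ν M = Equiv.Perm.sign π := by
  have key : ∀ σ τ : Equiv.Perm (Fin (2 * k)), IsPermOf ν D M σ → IsPermOf ν D M τ →
      Equiv.Perm.sign σ = Equiv.Perm.sign τ := by
    intro σ τ hσ hτ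
    choose e he het heh using hσ
    choose f hf hft hfh using hτ
    have hex : ∀ i, ∃ j, e j = f i := by
      intro i
      set m := σ.symm (τ ⟨2 * i, by omega⟩) with hm
      have hσm : σ m = τ ⟨2 * i, by omega⟩ := by simp [hm]
      refine ⟨⟨m / 2, by omega⟩, ?_⟩
      obtain ⟨g, -, hg⟩ := hM.2 (ν (σ m)) (ν (σ m)).2
      have hinc : G.Inc (e ⟨m / 2, by omega⟩) (ν (σ m)) := by
        rcases Nat.mod_two_eq_zero_or_one m with h0 | h0
        · have : m = ⟨2 * (m / 2), by omega⟩ := Fin.ext (by simp; omega)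
          refine ⟨D.head (e ⟨m / 2, by omega⟩), ?_⟩
          · have h2 := het ⟨m / 2, by omega⟩
            simp only at h2
            rw [← this] at h2
            rw [← h2]
            exact D.isLink _
        · have : m = ⟨2 * (m / 2) + 1, by omega⟩ := Fin.ext (by simp; omega)
          refine ⟨D.tail (e ⟨m / 2, by omega⟩), ?_⟩
          · have h2 := heh ⟨m / 2, by omega⟩
            simp only at h2
            rw [← this] at h2
            rw [← h2]
            exact (D.isLink _).symm
      have hinc' : G.Inc (f i) (ν (σ m)) := by
        rw [hσm, ← hft]
        exact ⟨_, D.isLink _⟩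
      exact Subtype.ext ((hg _ ⟨he _, hinc⟩).trans (hg _ ⟨hf _, hinc'⟩).symm)
    choose ρ hρ using hex
    have h0 : ∀ i, σ ⟨2 * ρ i, by omega⟩ = τ ⟨2 * i, by omega⟩ := fun i =>
      ν.injective (Subtype.ext (by rw [← het, ← hft, hρ]))
    have h1 : ∀ i, σ ⟨2 * ρ i + 1, by omega⟩ = τ ⟨2 * i + 1, by omega⟩ := fun i =>
      ν.injective (Subtype.ext (by rw [← heh, ← hfh, hρ]))
    have hinj : Function.Injective ρ := by
      intro i j hij
      have h := (h0 i).symm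
      simp only [hij, h0 j] at h
      have := congrArg Fin.val (τ.injective h)
      simp only at this
      exact Fin.ext (by omega)
    let r : Equiv.Perm (Fin k) := Equiv.ofBijective ρ (Finite.injective_iff_bijective.1 hinj)
    let φ : Fin k × Fin 2 ≃ Fin (2 * k) := finProdFinEquiv.trans (finCongr (mul_comm k 2))
    have hτσ : τ = σ * φ.permCongr (Equiv.prodCongrLeft fun _ : Fin 2 => r) := by
      ext m
      obtain ⟨⟨i, j⟩, rfl⟩ := φ.surjective m
      rw [Equiv.Perm.mul_apply, Equiv.permCongr_apply, Equiv.symm_apply_apply]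
      congr 1
      fin_cases j
      · convert (h0 i).symm using 2
        · exact Fin.ext (by simp [φ])
        · exact Fin.ext (by simp [φ, r])
      · convert (h1 i).symm using 2
        · exact Fin.ext (by simp [φ]; omega)
        · exact Fin.ext (by simp [φ, r]; omega)
    rw [hτσ, Equiv.Perm.sign_mul, Equiv.Perm.sign_permCongr, Equiv.Perm.sign_prodCongrLeft]
    simp
  have h : ∃ π, IsPermOf ν D M π := ⟨π, hπ⟩
  rw [sign, dif_pos h]
  exact key _ _ h.choose_spec hπ

end Orientation

/-- The signature matrix of an `m`-orientation `D`: one row for each perfect matching of `G`. -/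
noncomputable def signatureMatrix {G : Graph α β} {k m : ℕ} (ν : Fin (2 * k) ≃ V(G))
    (D : Fin m → G.Orientation) : Matrix {M : Set β // G.IsPerfectMatching M} (Fin m) ℝ :=
  Matrix.of fun M i => ((((D i).sign ν M.1 : ℤˣ) : ℤ) : ℝ)

open scoped Matrix in
/-- An `m`-orientation of `G` is pfaffian if the linear system given by its signature matrix and the
all-ones vector is solvable (this does not depend on the enumeration `ν` of the vertices). -/
def IsPfaffian {G : Graph α β} {m : ℕ} (D : Fin m → G.Orientation) : Prop :=
  ∀ (k : ℕ) (ν : Fin (2 * k) ≃ V(G)), ∃ x : Fin m → ℝ, signatureMatrix ν D *ᵥ x = 1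

/-- The pfaffian number `pf(G)`: the least positive integer `m` such that `G` has a pfaffian
`m`-orientation. -/
noncomputable def pfaffianNumber (G : Graph α β) : ℕ :=
  sInf {m : ℕ | 0 < m ∧ ∃ D : Fin m → G.Orientation, IsPfaffian D}

end Graph

/-! A perfect matching of `G / X` covers the contraction vertex by an edge whose end in `X` is some
boundary vertex `u`. Since `G / X̄` is matching covered, that edge lies in a perfect matching of `G
/ X̄`, so `X \ {u}` is matched up by edges of `G`. Fix one such matching for each boundary `u`. Its
block is the list of `X` that starts with `u` and continues with the ends of these edges. Adding the
block of `u` turns each perfect matching `M` of `G / X` into a perfect matching `N M` of `G`. The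
relative sign of `N M₀` and `N M` is that of `M₀` and `M` times that of the two blocks
(`exists_perm_sumElim`).

If all blocks have the same sign, the signature matrix of `G / X` thus consists of rows of that of
`G`, up to signs of columns, and a solution `x` carries over (`IsPfaffian.contract`).

Equal signs come from reversing a cut `∂(S)`. In the block of `u` this reverses `|S ∩ (X \ {u})|`
edges modulo 2, which is a constant plus 1 if `u ∈ S`. So let `S` meet `X` in the boundary vertices
whose block has the wrong sign (`exists_isBalanced_rev`). Only `S ∩ X` matters, so one `S` serves
both shores. The reversal keeps the orientation pfaffian, as `|M ∩ ∂(S)|` has the parity of `|S|`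
for each perfect matching `M` (`IsPfaffian.rev`). -/

namespace Graph

variable {α β : Type*}

/-! ### Lists of ends and relative signs of perfect matchings -/

namespace Orientation

variable {G : Graph α β}

/-- The list of ends of a family of edges: the tail of `f i` has index `(i, 0)`, the head `(i, 1)`. -/
def ends {ι : Type*} (D : G.Orientation) (f : ι → E(G)) (p : ι × Fin 2) : α :=
  if p.2 = 0 then D.tail (f p.1) else D.head (f p.1)

theorem inc_ends {ι : Type*} (D : G.Orientation) (f : ι → E(G)) (p : ι × Fin 2) :
    G.Inc (f p.1) (D.ends f p) := by
  unfold ends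
  split_ifs
  · exact (D.isLink _).inc_left
  · exact (D.isLink _).inc_right

theorem ends_mem {ι : Type*} (D : G.Orientation) (f : ι → E(G)) (p : ι × Fin 2) :
    D.ends f p ∈ V(G) :=
  (D.inc_ends f p).vertex_mem

theorem exists_ends_eq {ι : Type*} (D : G.Orientation) (f : ι → E(G)) {i : ι} {v : α}
    (h : G.Inc (f i) v) : ∃ j, D.ends f (i, j) = v := by
  rcases h.eq_or_eq_of_isLink (D.isLink (f i)) with h | h
  · exact ⟨0, by simp [ends, h]⟩
  · exact ⟨1, by simp [ends, h]⟩

theorem isLink_ends {ι : Type*} (D : G.Orientation) (f : ι → E(G)) (p : ι × Fin 2) :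
    G.IsLink (f p.1) (D.ends f p) (D.ends f (p.1, Equiv.swap 0 1 p.2)) := by
  obtain ⟨i, j⟩ := p
  fin_cases j
  · simpa [ends] using D.isLink (f i)
  · simpa [ends] using (D.isLink (f i)).symm

end Orientation

open Graph.Orientation

variable {G : Graph α β}

theorem nonempty_orientation (G : Graph α β) : Nonempty G.Orientation :=
  ⟨⟨fun e => (exists_isLink_of_mem_edgeSet e.2).choose,
    fun e => (exists_isLink_of_mem_edgeSet e.2).choose_spec.choose,
    fun e => (exists_isLink_of_mem_edgeSet e.2).choose_spec.choose_spec⟩⟩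

/-- A set `N` of edges matching up a finite set `W` of vertices can be listed so that the ends
of the list run through `W` exactly once. -/
theorem exists_bijOn_ends [G.Loopless] {N : Set β} {W : Set α} (hW : W.Finite)
    (hN : ∀ e ∈ N, e ∈ E(G) ∧ ∀ v, G.Inc e v → v ∈ W)
    (hu : ∀ v ∈ W, ∃! e, e ∈ N ∧ G.Inc e v) {k : ℕ} (hk : W.ncard / 2 = k) :
    ∃ f : Fin k → E(G), (∀ i, (f i : β) ∈ N) ∧
      ∀ D : G.Orientation, Set.BijOn (D.ends f) Set.univ W := by
  let f : N → E(G) := fun e => ⟨e, (hN e e.2).1⟩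
  have hf : ∀ D : G.Orientation, Set.BijOn (D.ends f) Set.univ W := by
    intro D
    refine ⟨fun p _ => (hN p.1 p.1.2).2 _ (D.inc_ends f p), ?_, ?_⟩
    · rintro ⟨i, a⟩ - ⟨j, b⟩ - h
      have hi := D.inc_ends f (i, a)
      have hj := D.inc_ends f (j, b)
      rw [← h] at hj
      obtain rfl : i = j := Subtype.ext
        ((hu _ ((hN i i.2).2 _ hi)).unique ⟨i.2, hi⟩ ⟨j.2, hj⟩)
      -- Looplessness tells the two ends of one edge apart.
      have hne := (D.isLink (f i)).ne
      have : a = b := by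
        fin_cases a <;> fin_cases b <;> simp_all [ends]
      rw [this]
    · intro v hv
      obtain ⟨e, ⟨he, hi⟩, -⟩ := hu v hv
      obtain ⟨j, hj⟩ := D.exists_ends_eq f (i := ⟨e, he⟩) hi
      exact ⟨_, trivial, hj⟩
  obtain ⟨D⟩ := nonempty_orientation G
  have hWc := Set.ncard_congr' ((Set.BijOn.equiv _ (hf D)).symm)
  have hc : Nat.card (N × Fin 2) = W.ncard := by
    rw [hWc, Set.ncard_univ]
  have hfin : Finite (N × Fin 2) := by
    have : Finite W := hW
    exact Finite.of_equiv _ ((Set.BijOn.equiv _ (hf D)).symm.trans (Equiv.Set.univ _))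
  have hNf : Finite N := Finite.of_injective (fun e : N => (e, (0 : Fin 2)))
    fun a b h => (Prod.ext_iff.1 h).1
  rw [Nat.card_prod, Nat.card_fin] at hc
  have hNk : Nat.card N = k := by omega
  let g : Fin k ≃ N := (Finite.equivFinOfCardEq hNk).symm
  refine ⟨f ∘ g, fun i => (g i).2, fun D => ?_⟩
  have he : D.ends (f ∘ g) = D.ends f ∘ (g.prodCongr (Equiv.refl (Fin 2))) := rfl
  rw [he]
  exact (hf D).comp (Set.bijOn_univ.2 (Equiv.bijective _))

/-- If the ends of a list of edges run through all vertices exactly once, these edges form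
a perfect matching. -/
theorem isPerfectMatching_range {ι : Type*} {D : G.Orientation} {f : ι → E(G)}
    (hf : Set.BijOn (D.ends f) Set.univ V(G)) :
    G.IsPerfectMatching (Set.range fun i => (f i : β)) := by
  refine ⟨?_, fun v hv => ?_⟩
  · rintro _ ⟨i, rfl⟩
    exact (f i).2
  · obtain ⟨p, -, rfl⟩ := hf.surjOn hv
    refine ⟨f p.1, ⟨⟨_, rfl⟩, D.inc_ends f p⟩, ?_⟩
    rintro _ ⟨⟨i, rfl⟩, hi⟩
    obtain ⟨j, hj⟩ := D.exists_ends_eq f hi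
    rw [← hf.injOn trivial trivial hj]

/-- Source of all the permutations whose signs serve as relative signs. -/
theorem exists_perm_comp_eq {κ : Type*} {W : Set α} {a b : κ → α}
    (ha : Set.BijOn a Set.univ W) (hb : Set.BijOn b Set.univ W) :
    ∃ r : Equiv.Perm κ, ∀ p, a (r p) = b p := by
  let ea := (Equiv.Set.univ κ).symm.trans (Set.BijOn.equiv _ ha)
  let eb := (Equiv.Set.univ κ).symm.trans (Set.BijOn.equiv _ hb)
  refine ⟨eb.trans ea.symm, fun p => ?_⟩
  exact congrArg Subtype.val (ea.apply_symm_apply (eb p))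

theorem card_eq_of_bijOn_ends {ι : Type*} [Fintype ι] {D : G.Orientation} {f : ι → E(G)}
    {W : Set α} (hf : Set.BijOn (D.ends f) Set.univ W) : W.ncard = 2 * Fintype.card ι := by
  have := Set.ncard_congr' ((Set.BijOn.equiv _ hf).symm)
  rw [this, Set.ncard_univ, Nat.card_prod, Nat.card_fin, Nat.card_eq_fintype_card, mul_comm]

/-- The relative sign of two perfect matchings, possibly in two different orientations, is the sign
of the permutation relating their lists of ends. -/
theorem sign_mul_sign {ι : Type*} [Fintype ι] [DecidableEq ι] {D D' : G.Orientation}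
    {M M' : Set β} (hM : G.IsPerfectMatching M) (hM' : G.IsPerfectMatching M')
    {f f' : ι → E(G)} (hf : Set.BijOn (D.ends f) Set.univ V(G))
    (hfM : ∀ i, (f i : β) ∈ M) (hfM' : ∀ i, (f' i : β) ∈ M')
    {r : Equiv.Perm (ι × Fin 2)} (hr : ∀ p, D.ends f (r p) = D'.ends f' p)
    {n : ℕ} (ν : Fin (2 * n) ≃ V(G)) :
    D.sign ν M * D'.sign ν M' = Equiv.Perm.sign r := by
  have hc : Fintype.card ι = n := by
    have h1 := card_eq_of_bijOn_ends hf
    have h2 : V(G).ncard = 2 * n := by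
      rw [← Nat.card_coe_set_eq, ← Nat.card_congr ν, Nat.card_fin]
    omega
  let g : Fin n ≃ ι := (Fintype.equivFinOfCardEq hc).symm
  let φ : Fin n × Fin 2 ≃ Fin (2 * n) := finProdFinEquiv.trans (finCongr (mul_comm n 2))
  let ψ : Fin (2 * n) ≃ ι × Fin 2 := φ.symm.trans (g.prodCongr (Equiv.refl _))
  have hψ0 : ∀ i : Fin n, ψ ⟨2 * i, by omega⟩ = (g i, 0) := by
    intro i
    have : (⟨2 * i, by omega⟩ : Fin (2 * n)) = φ (i, 0) := Fin.ext (by simp [φ])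
    simp [ψ, this]
  have hψ1 : ∀ i : Fin n, ψ ⟨2 * i + 1, by omega⟩ = (g i, 1) := by
    intro i
    have : (⟨2 * i + 1, by omega⟩ : Fin (2 * n)) = φ (i, 1) := Fin.ext (by simp [φ]; omega)
    simp [ψ, this]
  let ea := (Equiv.Set.univ (ι × Fin 2)).symm.trans (Set.BijOn.equiv _ hf)
  have hea : ∀ p, (ea p : α) = D.ends f p := fun p => rfl
  -- Both permutations read the vertices through the list of `f` in `D`. Preceded by `r`, this list
  -- becomes that of `f'` in `D'`, so `π` and `π'` differ by a conjugate of `r`.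
  let π : Equiv.Perm (Fin (2 * n)) := (ψ.trans ea).trans ν.symm
  let π' : Equiv.Perm (Fin (2 * n)) := ((ψ.trans r).trans ea).trans ν.symm
  have h1 : IsPermOf ν D M π := by
    intro i
    refine ⟨f (g i), hfM _, ?_, ?_⟩
    · simp [π, hψ0, hea, ends]
    · simp [π, hψ1, hea, ends]
  have h2 : IsPermOf ν D' M' π' := by
    intro i
    refine ⟨f' (g i), hfM' _, ?_, ?_⟩
    · simp [π', hψ0, hea, hr]; simp [ends]
    · simp [π', hψ1, hea, hr]; simp [ends]
  rw [sign_eq hM h1, sign_eq hM' h2]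
  have : π' = π * ψ.symm.permCongr r := by
    ext x
    simp [π, π', Equiv.permCongr_apply]
  rw [this, Equiv.Perm.sign_mul, ← mul_assoc, Int.units_mul_self, one_mul,
    Equiv.Perm.sign_permCongr]

/-! ### Reversing a cut -/

section Reversal

open Classical in
/-- The sign `-1` on the vertices of `S`, and `1` elsewhere. -/
noncomputable def shoreSign (S : Set α) (v : α) : ℤˣ := if v ∈ S then -1 else 1

open Classical in
/-- The permutation of the list of ends of `f` caused by reversing the cut of `S`. -/
noncomputable def reversePerm (G : Graph α β) {ι : Type*} (S : Set α) (f : ι → E(G)) :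
    Equiv.Perm (ι × Fin 2) :=
  Equiv.prodCongrRight fun i => if (f i : β) ∈ G.cut S then Equiv.swap 0 1 else 1

theorem ends_reversePerm {ι : Type*} (D : G.Orientation) (S : Set α) (f : ι → E(G))
    (p : ι × Fin 2) : D.ends f (G.reversePerm S f p) = (D.rev (G.cut S)).ends f p := by
  obtain ⟨i, j⟩ := p
  by_cases h : (f i : β) ∈ G.cut S <;> fin_cases j <;> simp [reversePerm, ends, rev, h]

theorem mem_cut_iff_of_isLink {S : Set α} {e : β} {u v : α} (h : G.IsLink e u v) :
    e ∈ G.cut S ↔ ¬ (u ∈ S ↔ v ∈ S) := by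
  constructor
  · rintro ⟨x, hx, y, hy, hl⟩
    rcases h.eq_and_eq_or_eq_and_eq hl with ⟨rfl, rfl⟩ | ⟨rfl, rfl⟩ <;> simp [hx, hy]
  · intro hn
    by_cases hu : u ∈ S
    · exact ⟨u, hu, v, by tauto, h⟩
    · exact ⟨v, by tauto, u, hu, h.symm⟩

/-- Each reversed edge contributes a transposition, and an edge is in the cut exactly when the signs
of its two ends multiply to `-1`. -/
theorem sign_reversePerm {ι : Type*} [Fintype ι] [DecidableEq ι] (D : G.Orientation) (S : Set α)
    (f : ι → E(G)) :
    Equiv.Perm.sign (G.reversePerm S f) = ∏ p, shoreSign S (D.ends f p) := by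
  rw [reversePerm, Equiv.Perm.sign_prodCongrRight, Fintype.prod_prod_type]
  refine Finset.prod_congr rfl fun i _ => ?_
  rw [Fin.prod_univ_two]
  have := mem_cut_iff_of_isLink (S := S) (D.isLink (f i))
  by_cases ht : D.tail (f i) ∈ S <;> by_cases hh : D.head (f i) ∈ S <;>
    simp [ends, shoreSign, this, ht, hh]

theorem IsPerfectMatching.exists_bijOn_ends [G.Loopless] (hV : V(G).Finite) {M : Set β}
    (hM : G.IsPerfectMatching M) {k : ℕ} (hk : V(G).ncard / 2 = k) :
    ∃ f : Fin k → E(G), (∀ i, (f i : β) ∈ M) ∧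
      ∀ D : G.Orientation, Set.BijOn (D.ends f) Set.univ V(G) :=
  Graph.exists_bijOn_ends hV (fun _ he => ⟨hM.1 he, fun _ hv => hv.vertex_mem⟩) hM.2 hk

/-- Reversing a cut changes the signs of all perfect matchings by the same factor. -/
theorem exists_sign_rev_eq [G.Loopless] (hV : V(G).Finite) (D : G.Orientation) (S : Set α) {n : ℕ}
    (ν : Fin (2 * n) ≃ V(G)) : ∃ c : ℤˣ, ∀ M, G.IsPerfectMatching M →
      D.sign ν M = c * (D.rev (G.cut S)).sign ν M := by
  by_cases h : ∃ M, G.IsPerfectMatching M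
  · obtain ⟨M₀, hM₀⟩ := h
    obtain ⟨f₀, -, hf₀⟩ := hM₀.exists_bijOn_ends hV rfl
    -- This is `(-1) ^ |S ∩ V(G)|`: the list of any perfect matching runs through `V(G)` once, so
    -- the product is the same for all of them.
    refine ⟨∏ p, shoreSign S (D.ends f₀ p), fun M hM => ?_⟩
    obtain ⟨f, hfM, hf⟩ := hM.exists_bijOn_ends hV rfl
    obtain ⟨r, hr⟩ := exists_perm_comp_eq (hf₀ D) (hf D)
    have h1 := sign_mul_sign hM hM (hf D) hfM hfM (ends_reversePerm D S f) ν
    rw [sign_reversePerm D] at h1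
    have h2 : ∏ p, shoreSign S (D.ends f p) = ∏ p, shoreSign S (D.ends f₀ p) := by
      simp_rw [← hr]
      exact Equiv.prod_comp r fun p => shoreSign S (D.ends f₀ p)
    rw [← h2, ← h1, mul_assoc, Int.units_mul_self, mul_one]
  · exact ⟨1, fun M hM => (h ⟨M, hM⟩).elim⟩

/-- Each column of the signature matrix is multiplied by a constant sign, which the corresponding
coordinate of the solution absorbs. -/
theorem IsPfaffian.rev [G.Loopless] (hV : V(G).Finite) {m : ℕ} {D : Fin m → G.Orientation}
    (hD : IsPfaffian D) (S : Fin m → Set α) :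
    IsPfaffian fun i => (D i).rev (G.cut (S i)) := by
  intro n ν
  obtain ⟨x, hx⟩ := hD n ν
  choose c hc using fun i => exists_sign_rev_eq hV (D i) (S i) ν
  refine ⟨fun i => ((c i : ℤ) : ℝ) * x i, ?_⟩
  ext M
  rw [← congrFun hx M]
  simp only [Matrix.mulVec, dotProduct]
  refine Finset.sum_congr rfl fun i _ => ?_
  simp only [signatureMatrix, Matrix.of_apply, hc i M.1 M.2]
  push_cast
  ring

end Reversal


/-! ### Vertices and incidences of a contraction -/

section Contraction

theorem contractVertex_of_mem {X : Set α} {v : α} (h : v ∈ X) : contractVertex X v = none :=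
  if_pos h

theorem contractVertex_of_notMem {X : Set α} {v : α} (h : v ∉ X) :
    contractVertex X v = some v :=
  if_neg h

theorem contractVertex_eq_none {X : Set α} {v : α} : contractVertex X v = none ↔ v ∈ X := by
  simp [contractVertex]

theorem contractVertex_eq_some {X : Set α} {v w : α} :
    contractVertex X v = some w ↔ v = w ∧ v ∉ X := by
  by_cases h : v ∈ X <;> simp [contractVertex, h]

theorem contract_inc {X : Set α} {e : β} {a : Option α} :
    (G.contract X).Inc e a ↔ e ∉ G.innerEdges X ∧ ∃ v, G.Inc e v ∧ contractVertex X v = a := by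
  rw [contract, map_inc]
  constructor
  · rintro ⟨v, hv, rfl⟩
    exact ⟨(deleteEdges_inc.1 hv).2, v, (deleteEdges_inc.1 hv).1, rfl⟩
  · rintro ⟨he, v, hv, rfl⟩
    exact ⟨v, deleteEdges_inc.2 ⟨hv, he⟩, rfl⟩

theorem mem_contract {X : Set α} {a : Option α} :
    a ∈ V(G.contract X) ↔ ∃ v ∈ V(G), contractVertex X v = a := Iff.rfl

theorem contract_loopless (G : Graph α β) [G.Loopless] (X : Set α) : (G.contract X).Loopless := by
  refine ⟨fun e a => ?_⟩
  rintro ⟨u, v, ⟨hl, he⟩, rfl, huv⟩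
  by_cases hu : u ∈ X
  · rw [contractVertex_of_mem hu, contractVertex_eq_none] at huv
    exact he ⟨u, hu, v, huv, hl⟩
  · rw [contractVertex_of_notMem hu, contractVertex_eq_some] at huv
    exact hl.ne huv.1.symm

end Contraction

/-! ### Blocks: matchings of a shore minus one vertex -/

section Blocks

/-- The vertex `u` followed by the list of ends of the edges of `g`. -/
def blockEnds {ι : Type*} (D : G.Orientation) (g : ι → E(G)) (u : α) : Option (ι × Fin 2) → α
  | none => u
  | some q => D.ends g q

/-- The vertices of `X` with a neighbour outside `X`. -/
def boundary (G : Graph α β) (X : Set α) : Set α :=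
  {u | u ∈ X ∧ ∃ e, ∃ v ∉ X, G.IsLink e u v}

/-- If each edge of the cut of `X` lies in a perfect matching of `G / (V(G) \ X)`, then `X` minus
any vertex of its boundary is matched up by edges of `G`. -/
theorem exists_bijOn_blockEnds [G.Loopless] (hV : V(G).Finite) {X : Set α} (hX : X ⊆ V(G))
    (h : (G.contract (V(G) \ X)).IsMatchingCovered) {u : α} (hu : u ∈ G.boundary X) :
    ∃ g : Fin ((X.ncard - 1) / 2) → E(G), ∀ D : G.Orientation,
      Set.BijOn (blockEnds D g u) Set.univ X := by
  obtain ⟨huX, e, v, hvX, hl⟩ := hu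
  have heI : e ∉ G.innerEdges (V(G) \ X) := by
    rintro ⟨x, hx, y, hy, hxy⟩
    rcases hl.left_eq_or_eq hxy with rfl | rfl
    · exact hx.2 huX
    · exact hy.2 huX
  have huY : u ∉ V(G) \ X := fun h => h.2 huX
  have hvY : v ∈ V(G) \ X := ⟨hl.right_mem, hvX⟩
  obtain ⟨M, hM, heM⟩ := h.2.2 e ⟨hl.edge_mem, heI⟩
  have hen : (G.contract (V(G) \ X)).Inc e none :=
    contract_inc.2 ⟨heI, v, hl.inc_right, contractVertex_of_mem hvY⟩
  have heu : (G.contract (V(G) \ X)).Inc e (some u) :=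
    contract_inc.2 ⟨heI, u, hl.inc_left, contractVertex_of_notMem huY⟩
  have hXf : (X \ {u}).Finite := (hV.subset hX).subset Set.sdiff_subset
  -- `e` already covers both `u` and the contraction vertex, so the other edges of `M` avoid `u` and
  -- stay inside `X`.
  have hN : ∀ e' ∈ M \ {e}, e' ∈ E(G) ∧ ∀ w, G.Inc e' w → w ∈ X \ {u} := by
    rintro e' ⟨he', hne⟩
    have heE := hM.1 he'
    refine ⟨heE.1, fun w hw => ⟨?_, ?_⟩⟩
    · by_contra hwX
      have hwY : w ∈ V(G) \ X := ⟨hw.vertex_mem, hwX⟩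
      have hi : (G.contract (V(G) \ X)).Inc e' none :=
        contract_inc.2 ⟨heE.2, w, hw, contractVertex_of_mem hwY⟩
      exact hne ((hM.2 _ hi.vertex_mem).unique ⟨he', hi⟩ ⟨heM, hen⟩)
    · rintro rfl
      have hi : (G.contract (V(G) \ X)).Inc e' (some w) :=
        contract_inc.2 ⟨heE.2, w, hw, contractVertex_of_notMem huY⟩
      exact hne ((hM.2 _ hi.vertex_mem).unique ⟨he', hi⟩ ⟨heM, heu⟩)
  have hNu : ∀ w ∈ X \ {u}, ∃! e', e' ∈ M \ {e} ∧ G.Inc e' w := by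
    rintro w ⟨hwX, hwu⟩
    have hwY : w ∉ V(G) \ X := fun h => h.2 hwX
    obtain ⟨e', ⟨he', hi⟩, huniq⟩ := hM.2 (some w)
      (mem_contract.2 ⟨w, hX hwX, contractVertex_of_notMem hwY⟩)
    obtain ⟨heI', w', hw', hww⟩ := contract_inc.1 hi
    obtain ⟨rfl, -⟩ := contractVertex_eq_some.1 hww
    refine ⟨e', ⟨⟨he', ?_⟩, hw'⟩, ?_⟩
    · rintro rfl
      rcases hw'.eq_or_eq_of_isLink hl with rfl | rfl
      · exact hwu rfl
      · exact hvX hwX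
    · rintro f ⟨hf, hfi⟩
      exact huniq f ⟨hf.1, contract_inc.2 ⟨(hM.1 hf.1).2, w', hfi, hww⟩⟩
  -- The length does not depend on `u`, so blocks of different vertices have the same index type and
  -- can be compared.
  obtain ⟨g, -, hg⟩ := exists_bijOn_ends hXf hN hNu
    (k := (X.ncard - 1) / 2) (by rw [Set.ncard_sdiff_singleton_of_mem huX])
  refine ⟨g, fun D => ⟨?_, ?_, ?_⟩⟩
  · rintro (_ | q) -
    · exact huX
    · exact ((hg D).mapsTo (Set.mem_univ q)).1
  · rintro (_ | q) - (_ | q') - hqq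
    · rfl
    · exact (((hg D).mapsTo (Set.mem_univ q')).2 hqq.symm).elim
    · exact (((hg D).mapsTo (Set.mem_univ q)).2 hqq).elim
    · exact congrArg some ((hg D).injOn trivial trivial hqq)
  · intro w hw
    by_cases hwu : w = u
    · exact ⟨none, trivial, hwu.symm⟩
    · obtain ⟨q, -, hq⟩ := (hg D).surjOn ⟨hw, hwu⟩
      exact ⟨some q, trivial, hq⟩

/-- The blocks given by `g` all have the same sign in `D`. -/
def IsBalanced {ι : Type*} [Fintype ι] [DecidableEq ι] (D : G.Orientation) (U : Set α)
    (g : α → ι → E(G)) : Prop :=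
  ∀ u ∈ U, ∀ u' ∈ U, ∃ r : Equiv.Perm (Option (ι × Fin 2)), Equiv.Perm.sign r = 1 ∧
    ∀ o, blockEnds D (g u') u' (r o) = blockEnds D (g u) u o

/-- Blocks become balanced after the reversal of a suitable cut, only the trace of which in `X`
matters. -/
theorem exists_isBalanced_rev {ι : Type*} [Fintype ι] [DecidableEq ι] (D : G.Orientation)
    {X U : Set α} (hU : U ⊆ X) (g : α → ι → E(G))
    (hg : ∀ u ∈ U, Set.BijOn (blockEnds D (g u) u) Set.univ X) :
    ∃ T ⊆ X, ∀ S, S ∩ X = T → IsBalanced (D.rev (G.cut S)) U g := by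
  rcases U.eq_empty_or_nonempty with rfl | ⟨u₀, hu₀⟩
  · exact ⟨∅, Set.empty_subset _, fun S _ u hu => hu.elim⟩
  have hr : ∀ u, ∃ r : Equiv.Perm (Option (ι × Fin 2)), u ∈ U →
      ∀ o, blockEnds D (g u₀) u₀ (r o) = blockEnds D (g u) u o := by
    intro u
    by_cases hu : u ∈ U
    · obtain ⟨r, hr⟩ := exists_perm_comp_eq (hg u₀ hu₀) (hg u hu)
      exact ⟨r, fun _ => hr⟩
    · exact ⟨1, fun h => (hu h).elim⟩
  choose r hr using hr
  -- The vertices whose block differs in sign from that of `u₀`.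
  refine ⟨{u | u ∈ U ∧ Equiv.Perm.sign (r u) = -1}, fun u hu => hU hu.1, fun S hS => ?_⟩
  let a : α → Equiv.Perm (Option (ι × Fin 2)) := fun u =>
    r u * Equiv.optionCongr (G.reversePerm S (g u))
  have ha : ∀ u ∈ U, ∀ o, blockEnds (D.rev (G.cut S)) (g u) u o =
      blockEnds D (g u₀) u₀ (a u o) := by
    intro u hu o
    rw [Equiv.Perm.mul_apply, hr u hu]
    rcases o with _ | q
    · rfl
    · exact (ends_reversePerm D S (g u) q).symm
  -- The reversal gives the product of `shoreSign S` over `X \ {u}`. By the choice of the trace of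
  -- `S`, the sign of `r u` is the missing factor at `u`, and the full product over `X` is
  -- independent of `u`.
  have hs : ∀ u ∈ U, Equiv.Perm.sign (a u) =
      ∏ o, shoreSign S (blockEnds D (g u₀) u₀ o) := by
    intro u hu
    have h1 : ∏ o, shoreSign S (blockEnds D (g u₀) u₀ o) =
        shoreSign S u * ∏ q, shoreSign S (D.ends (g u) q) := by
      rw [← Equiv.prod_comp (r u)]
      simp_rw [hr u hu]
      exact Fintype.prod_option _
    have h2 : shoreSign S u = Equiv.Perm.sign (r u) := by
      have h3 : u ∈ S ↔ Equiv.Perm.sign (r u) = -1 := by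
        have := Set.ext_iff.1 hS u
        simp only [Set.mem_inter_iff, hU hu, and_true, Set.mem_ofPred_eq, hu, true_and] at this
        exact this
      unfold shoreSign
      split_ifs with h
      · exact (h3.1 h).symm
      · exact ((Int.units_eq_one_or _).resolve_right fun h' => h (h3.2 h')).symm
    rw [h1, h2, Equiv.Perm.sign_mul, Equiv.optionCongr_sign, sign_reversePerm D]
  intro u hu u' hu'
  refine ⟨(a u')⁻¹ * a u, ?_, fun o => ?_⟩
  · rw [Equiv.Perm.sign_mul, Equiv.Perm.sign_inv, hs u hu, hs u' hu', Int.units_mul_self]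
  · rw [ha u' hu', ha u hu, ← Equiv.Perm.mul_apply, mul_inv_cancel_left]

end Blocks

/-! ### Extending matchings of the contraction to the whole graph -/

section Transfer

/-- Replacing the contraction vertex in two lists by blocks multiplies the relative sign of
the lists by the relative sign of the blocks. -/
theorem exists_perm_sumElim {κ κ' : Type*} [Fintype κ] [DecidableEq κ] [Fintype κ']
    [DecidableEq κ'] {X : Set α} {a a₀ : κ → α} {b b₀ : Option κ' → α}
    {r : Equiv.Perm κ} (hr : ∀ p, contractVertex X (a₀ (r p)) = contractVertex X (a p))
    {p : κ} (hp : ∀ q, a q ∈ X → q = p) {s : Equiv.Perm (Option κ')}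
    (hs : ∀ o, b₀ (s o) = b o) (hb : b none = a p) (hb₀ : b₀ none = a₀ (r p)) :
    ∃ R : Equiv.Perm (κ ⊕ κ'), Equiv.Perm.sign R = Equiv.Perm.sign r * Equiv.Perm.sign s ∧
      ∀ z, Sum.elim a₀ (b₀ ∘ some) (R z) = Sum.elim a (b ∘ some) z := by
  classical
  -- The first vertex of the block already occurs in the list `a`, at position `p`; only the rest of
  -- the block is appended.
  let j : Option κ' → κ ⊕ κ' := fun o => o.elim (Sum.inl p) Sum.inr
  have hj : Function.Injective j := by
    rintro (_ | x) (_ | y) h <;> simp_all [j]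
  let e : Option κ' ≃ {z // z ∈ Set.range j} := Equiv.ofInjective j hj
  have hR : ∀ o, s.extendDomain e (j o) = j (s o) := fun o =>
    Equiv.Perm.extendDomain_apply_image s e o
  have hj₀ : ∀ o, Sum.elim a₀ (b₀ ∘ some) (Equiv.Perm.sumCongr r 1 (j o)) = b₀ o := by
    rintro (_ | x)
    · exact hb₀.symm
    · rfl
  have hj₁ : ∀ o, Sum.elim a (b ∘ some) (j o) = b o := by
    rintro (_ | x)
    · exact hb.symm
    · rfl
  refine ⟨Equiv.Perm.sumCongr r 1 * s.extendDomain e, ?_, fun z => ?_⟩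
  · rw [Equiv.Perm.sign_mul, Equiv.Perm.sign_sumCongr, Equiv.Perm.sign_one, mul_one,
      Equiv.Perm.sign_extendDomain]
  · rw [Equiv.Perm.mul_apply]
    by_cases hz : z ∈ Set.range j
    · obtain ⟨o, rfl⟩ := hz
      rw [hR, hj₀, hj₁, hs]
    · rw [Equiv.Perm.extendDomain_apply_not_subtype _ _ hz]
      rcases z with q | x
      · have hq : a q ∉ X := fun h => hz ⟨none, by rw [hp q h]; rfl⟩
        have := hr q
        rw [contractVertex_of_notMem hq, contractVertex_eq_some] at this
        exact this.1
      · exact (hz ⟨some x, rfl⟩).elim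

/-- A family of edges of a contraction, as edges of the graph itself. -/
def liftEdges {ι : Type*} {X : Set α} (f : ι → E(G.contract X)) (i : ι) : E(G) :=
  ⟨f i, (f i).2.1⟩

theorem ends_contract {ι : Type*} {X : Set α} (D : G.Orientation) (f : ι → E(G.contract X))
    (p : ι × Fin 2) :
    (D.contract X).ends f p = contractVertex X (D.ends (liftEdges f) p) := by
  unfold ends
  split_ifs <;> rfl

/-- The contraction vertex has a unique position in the list of ends of a perfect matching. -/
theorem exists_unique_position {ι : Type*} {X : Set α} (hX : X ⊆ V(G)) (hXn : X.Nonempty)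
    {D : G.Orientation} {f : ι → E(G.contract X)}
    (hf : Set.BijOn ((D.contract X).ends f) Set.univ V(G.contract X)) :
    ∃ p, D.ends (liftEdges f) p ∈ G.boundary X ∧
      ∀ q, D.ends (liftEdges f) q ∈ X → q = p := by
  obtain ⟨x, hx⟩ := hXn
  obtain ⟨p, -, hp⟩ := hf.surjOn (mem_contract.2 ⟨x, hX hx, contractVertex_of_mem hx⟩)
  rw [ends_contract, contractVertex_eq_none] at hp
  refine ⟨p, ⟨hp, _, _, ?_, D.isLink_ends (liftEdges f) p⟩, fun q hq => ?_⟩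
  -- Edges inside `X` are deleted in the contraction, so the other end lies outside `X`.
  · exact fun hy => (f p.1).2.2 ⟨_, hp, _, hy, D.isLink_ends (liftEdges f) p⟩
  · refine hf.injOn trivial trivial ?_
    rw [ends_contract, ends_contract, contractVertex_of_mem hp, contractVertex_of_mem hq]

theorem ends_sumElim {ι κ : Type*} (D : G.Orientation) (f : ι → E(G)) (g : κ → E(G))
    (p : (ι ⊕ κ) × Fin 2) :
    D.ends (Sum.elim f g) p =
      Sum.elim (D.ends f) (D.ends g) (Equiv.sumProdDistrib ι κ (Fin 2) p) := by
  rcases p with ⟨i | i, j⟩ <;> rfl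

/-- The lifted list meets `X` only at position `p`; the block that starts with this vertex supplies
the rest of `X`. -/
theorem bijOn_ends_sumElim {ι κ : Type*} {X : Set α}
    {D : G.Orientation} {f : ι → E(G.contract X)}
    (hf : Set.BijOn ((D.contract X).ends f) Set.univ V(G.contract X))
    {p : ι × Fin 2} (hp : ∀ q, D.ends (liftEdges f) q ∈ X → q = p) {g : κ → E(G)}
    (hg : Set.BijOn (blockEnds D g (D.ends (liftEdges f) p)) Set.univ X) :
    Set.BijOn (D.ends (Sum.elim (liftEdges f) g)) Set.univ V(G) := by
  have hgX : ∀ q, D.ends g q ∈ X := fun q => hg.mapsTo (Set.mem_univ (some q))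
  have hne : ∀ q q', D.ends (liftEdges f) q ≠ D.ends g q' := by
    intro q q' h
    obtain rfl := hp q (h ▸ hgX q')
    exact absurd (hg.injOn (Set.mem_univ none) (Set.mem_univ (some q')) h) (by simp)
  have key : Set.BijOn (Sum.elim (D.ends (liftEdges f)) (D.ends g)) Set.univ V(G) := by
    refine ⟨?_, ?_, ?_⟩
    · rintro (q | q) -
      · exact D.ends_mem _ _
      · exact D.ends_mem _ _
    · rintro (q | q) - (q' | q') - h
      · refine congrArg Sum.inl (hf.injOn trivial trivial ?_)
        rw [ends_contract, ends_contract]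
        exact congrArg _ h
      · exact (hne _ _ h).elim
      · exact (hne _ _ h.symm).elim
      · exact congrArg Sum.inr (Option.some.inj (hg.injOn (Set.mem_univ (some q))
          (Set.mem_univ (some q')) h))
    · intro v hv
      by_cases hvX : v ∈ X
      · obtain ⟨_ | q, -, hq⟩ := hg.surjOn hvX
        · exact ⟨Sum.inl p, trivial, hq⟩
        · exact ⟨Sum.inr q, trivial, hq⟩
      · obtain ⟨q, -, hq⟩ := hf.surjOn (mem_contract.2 ⟨v, hv, contractVertex_of_notMem hvX⟩)
        rw [ends_contract, contractVertex_eq_some] at hq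
        exact ⟨Sum.inl q, trivial, hq.1⟩
  have he : D.ends (Sum.elim (liftEdges f) g) =
      Sum.elim (D.ends (liftEdges f)) (D.ends g) ∘ Equiv.sumProdDistrib ι κ (Fin 2) :=
    funext fun q => ends_sumElim D _ _ q
  rw [he]
  exact key.comp (Set.bijOn_univ.2 (Equiv.bijective _))

/-- A pfaffian orientation induces a pfaffian orientation of `G / X` if it balances the blocks
inside `X`. -/
theorem IsPfaffian.contract [G.Loopless] (hV : V(G).Finite) {X : Set α} (hX : X ⊆ V(G))
    (hXn : X.Nonempty) {l m : ℕ} {D : Fin m → G.Orientation} (hD : IsPfaffian D)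
    {g : α → Fin l → E(G)}
    (hg : ∀ u ∈ G.boundary X, ∀ D : G.Orientation, Set.BijOn (blockEnds D (g u) u) Set.univ X)
    (hbal : ∀ i, IsBalanced (D i) (G.boundary X) g) :
    IsPfaffian fun i => (D i).contract X := by
  have := contract_loopless G X
  intro k ν
  by_cases hM₀ : ∃ M, (G.contract X).IsPerfectMatching M
  swap
  -- Without perfect matchings the system has no rows.
  · exact ⟨0, funext fun M => (hM₀ ⟨M.1, M.2⟩).elim⟩
  obtain ⟨M₀, hM₀⟩ := hM₀
  have hcard : V(G.contract X).ncard = 2 * k := by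
    rw [← Nat.card_coe_set_eq, ← Nat.card_congr ν, Nat.card_fin]
  have hVc : V(G.contract X).Finite := hV.image _
  -- The vertex `u` must not depend on the orientation, since one extension of `M` has to serve all
  -- the `D i`; only its position in the list may vary.
  have hext : ∀ M, (G.contract X).IsPerfectMatching M → ∃ f : Fin k → E(G.contract X),
      (∀ i, (f i : β) ∈ M) ∧
      (∀ D : G.Orientation, Set.BijOn ((D.contract X).ends f) Set.univ V(G.contract X)) ∧
      ∃ u ∈ G.boundary X, ∀ D : G.Orientation, ∃ p, D.ends (liftEdges f) p = u ∧
        ∀ q, D.ends (liftEdges f) q ∈ X → q = p := by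
    intro M hM
    obtain ⟨f, hfM, hf⟩ := hM.exists_bijOn_ends hVc (k := k) (by omega)
    obtain ⟨D₁⟩ := nonempty_orientation G
    obtain ⟨p, hp, -⟩ := exists_unique_position hX hXn (hf (D₁.contract X))
    refine ⟨f, hfM, fun D => hf _, _, hp, fun D => ?_⟩
    obtain ⟨j, hj⟩ := D.exists_ends_eq (liftEdges f) (D₁.inc_ends (liftEdges f) p)
    obtain ⟨q, -, hq⟩ := exists_unique_position hX hXn (hf (D.contract X))
    have hjq := hq _ (hj ▸ hp.1)
    exact ⟨q, hjq ▸ hj, hq⟩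
  obtain ⟨f₁, -, -, u₁, -⟩ := hext M₀ hM₀
  have : Nonempty (Fin k → E(G.contract X)) := ⟨f₁⟩
  have : Nonempty α := ⟨u₁⟩
  choose! f hfM hf u huX hu using hext
  let F : Set β → Fin k ⊕ Fin l → E(G) := fun M => Sum.elim (liftEdges (f M)) (g (u M))
  have hF : ∀ M, (G.contract X).IsPerfectMatching M → ∀ D : G.Orientation,
      Set.BijOn (D.ends (F M)) Set.univ V(G) := by
    intro M hM D
    obtain ⟨p, hp, hq⟩ := hu M hM D
    exact bijOn_ends_sumElim (hf M hM D) hq (hp ▸ hg (u M) (huX M hM) D)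
  let N : Set β → Set β := fun M => Set.range fun i => (F M i : β)
  obtain ⟨D₁⟩ := nonempty_orientation G
  have hN : ∀ M, (G.contract X).IsPerfectMatching M → G.IsPerfectMatching (N M) :=
    fun M hM => isPerfectMatching_range (hF M hM D₁)
  have hcG : Nat.card V(G) = 2 * (k + l) := by
    rw [Nat.card_coe_set_eq, card_eq_of_bijOn_ends (hF M₀ hM₀ D₁)]
    simp
  have : Finite V(G) := hV
  let μ : Fin (2 * (k + l)) ≃ V(G) := (Finite.equivFinOfCardEq hcG).symm
  have hsign : ∀ i M, (G.contract X).IsPerfectMatching M →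
      ((D i).contract X).sign ν M₀ * ((D i).contract X).sign ν M =
        (D i).sign μ (N M₀) * (D i).sign μ (N M) := by
    intro i M hM
    obtain ⟨r, hr⟩ := exists_perm_comp_eq (hf M₀ hM₀ (D i)) (hf M hM (D i))
    obtain ⟨s, hs1, hs⟩ := hbal i (u M) (huX M hM) (u M₀) (huX M₀ hM₀)
    obtain ⟨p, hp, hpq⟩ := hu M hM (D i)
    obtain ⟨p₀, hp₀, hpq₀⟩ := hu M₀ hM₀ (D i)
    have hr' : ∀ q, contractVertex X ((D i).ends (liftEdges (f M₀)) (r q)) =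
        contractVertex X ((D i).ends (liftEdges (f M)) q) := by
      intro q
      rw [← ends_contract, ← ends_contract, hr]
    have hrp : r p = p₀ := by
      refine hpq₀ _ ?_
      rw [← contractVertex_eq_none, hr', contractVertex_eq_none, hp]
      exact (huX M hM).1
    obtain ⟨R, hR1, hR⟩ := exists_perm_sumElim hr' hpq hs hp.symm (by rw [hrp]; exact hp₀.symm)
    let ε := Equiv.sumProdDistrib (Fin k) (Fin l) (Fin 2)
    have hR' : ∀ q, (D i).ends (F M₀) (ε.symm.permCongr R q) = (D i).ends (F M) q := by
      intro q
      rw [ends_sumElim, ends_sumElim, Equiv.permCongr_apply, Equiv.symm_symm,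
        Equiv.apply_symm_apply]
      exact hR (ε q)
    rw [sign_mul_sign hM₀ hM (hf M₀ hM₀ (D i)) (hfM M₀ hM₀) (hfM M hM) hr ν,
      sign_mul_sign (hN M₀ hM₀) (hN M hM) (hF M₀ hM₀ (D i)) (fun j => ⟨j, rfl⟩)
        (fun j => ⟨j, rfl⟩) hR' μ, Equiv.Perm.sign_permCongr, hR1, hs1, mul_one]
  obtain ⟨x, hx⟩ := hD (k + l) μ
  -- By `hsign`, the factor by which the signs of `M` and `N M` differ in column `i` is the same for
  -- all `M`; it is computed at `M₀`.
  refine ⟨fun i => (((((D i).contract X).sign ν M₀ * (D i).sign μ (N M₀) : ℤˣ) : ℤ) : ℝ) * x i, ?_⟩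
  ext M
  refine Eq.trans ?_ (congrFun hx ⟨N M.1, hN M.1 M.2⟩)
  simp only [Matrix.mulVec, dotProduct]
  refine Finset.sum_congr rfl fun i _ => ?_
  have h : ((D i).contract X).sign ν M.1 * (((D i).contract X).sign ν M₀ * (D i).sign μ (N M₀)) =
      (D i).sign μ (N M.1) := by
    rw [← mul_assoc, mul_comm (((D i).contract X).sign ν M.1), hsign i M.1 M.2, mul_right_comm,
      Int.units_mul_self, one_mul]
  simp only [signatureMatrix, Matrix.of_apply, ← h]
  push_cast
  ring

end Transfer

/-! ### Balancing both shores at once -/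

/-- A shore is nonempty if contracting its complement leaves a matching covered graph. -/
theorem IsMatchingCovered.nonempty_of_contract_compl {X : Set α}
    (h : (G.contract (V(G) \ X)).IsMatchingCovered) : X.Nonempty := by
  by_contra hX
  obtain rfl := Set.not_nonempty_iff_eq_empty.1 hX
  obtain ⟨e, he, hI⟩ := h.2.1
  obtain ⟨x, y, hl⟩ := exists_isLink_of_mem_edgeSet he
  exact hI ⟨x, ⟨hl.left_mem, fun h => h⟩, y, ⟨hl.right_mem, fun h => h⟩, hl⟩

/-- Within one shore `X`, the blocks for a separating cut, together with the vertices of `X` to be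
reversed in order to balance them. -/
theorem exists_blocks [G.Loopless] (hV : V(G).Finite) {X : Set α} (hX : X ⊆ V(G))
    (h : (G.contract (V(G) \ X)).IsMatchingCovered) {m : ℕ} (D : Fin m → G.Orientation) :
    ∃ g : α → Fin ((X.ncard - 1) / 2) → E(G),
      (∀ u ∈ G.boundary X, ∀ D : G.Orientation,
        Set.BijOn (blockEnds D (g u) u) Set.univ X) ∧
      ∃ T : Fin m → Set α, (∀ i, T i ⊆ X) ∧
        ∀ i S, S ∩ X = T i → IsBalanced ((D i).rev (G.cut S)) (G.boundary X) g := by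
  obtain ⟨e, he⟩ := h.2.1
  have hex : ∀ u, ∃ g : Fin ((X.ncard - 1) / 2) → E(G), u ∈ G.boundary X →
      ∀ D : G.Orientation, Set.BijOn (blockEnds D g u) Set.univ X := by
    intro u
    by_cases hu : u ∈ G.boundary X
    · obtain ⟨g, hg⟩ := exists_bijOn_blockEnds hV hX h hu
      exact ⟨g, fun _ => hg⟩
    -- Off the boundary any filler edge will do.
    · exact ⟨fun _ => ⟨e, he.1⟩, fun h => (hu h).elim⟩
  choose g hg using hex
  choose T hT hb using fun i => exists_isBalanced_rev (D i) (fun u (hu : u ∈ G.boundary X) => hu.1) g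
    fun u hu => hg u hu (D i)
  exact ⟨g, hg, T, hT, hb⟩

end Graph

theorem theorem4p4 {α β : Type*} (G : Graph α β) [G.Loopless]
    (hV : V(G).Finite) (hE : E(G).Finite) (hG : G.IsMatchingCovered)
    (X : Set α) (hX : X ⊆ V(G)) (hC : G.IsSeparatingCut X)
    (D₀ : Fin G.pfaffianNumber → G.Orientation) (hD₀ : Graph.IsPfaffian D₀) :
    ∃ D : Fin G.pfaffianNumber → G.Orientation,
      (∀ i, (D₀ i).Similar (D i)) ∧
      Graph.IsPfaffian (fun i => (D i).contract X) ∧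
      Graph.IsPfaffian (fun i => (D i).contract (V(G) \ X)) := by
  have hY : V(G) \ X ⊆ V(G) := Set.sdiff_subset
  have hXY : V(G) \ (V(G) \ X) = X := Set.sdiff_sdiff_cancel_left hX
  have hCX : (G.contract (V(G) \ (V(G) \ X))).IsMatchingCovered := hXY.symm ▸ hC.1
  obtain ⟨g, hg, T, hT, hb⟩ := Graph.exists_blocks hV hX hC.2 D₀
  obtain ⟨g', hg', T', hT', hb'⟩ := Graph.exists_blocks hV hY hCX D₀
  -- `T i` lies in `X` and `T' i` in its complement, so the union has the required trace on each
  -- shore.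
  have hpf := hD₀.rev hV fun i => T i ∪ T' i
  refine ⟨fun i => (D₀ i).rev (G.cut (T i ∪ T' i)), fun i => ⟨T i ∪ T' i,
    Set.union_subset ((hT i).trans hX) ((hT' i).trans hY), rfl⟩, ?_, ?_⟩
  · refine hpf.contract hV hX hC.2.nonempty_of_contract_compl hg fun i => hb i _ ?_
    ext v
    have h1 := @hT i v
    have h2 := @hT' i v
    simp only [Set.mem_inter_iff, Set.mem_union, Set.mem_sdiff] at *
    tauto
  · refine hpf.contract hV hY hCX.nonempty_of_contract_compl hg' fun i => hb' i _ ?_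
    ext v
    have h1 := @hT i v
    have h2 := @hT' i v
    simp only [Set.mem_inter_iff, Set.mem_union, Set.mem_sdiff] at *
    tauto
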